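/- Let $\mathcal M_*$ be the Gromov space: the set of pointed isometry classes $[M,x]$ of pointed proper metric spaces (all closed balls compact). For metric spaces $M,N$, a metric on $M\sqcup N$ is called admissible if it restricts to the given metrics on $M$ and $N$. For $R,r>0$ let $U_{R,r}$ be the set of pairs $([M,x],[N,y])$ for which there is an admissible metric $d$ on $M\sqcup N$ with $d(x,y)<r$ and $$\max\Bigl\{\sup_{u\in B_M(x,R)}d(u,N),\ \sup_{v\in B_N(y,R)}d(v,M)\Bigr\}<r ,$$ where $B_M(x,R)$ and $B_N(y,R)$ are open balls. Give $\mathcal M_*$ the topology in which a set $O$ is open if and only if for every $P\in O$ there are $R,r>0$ with $U_{R,r}(P)\subset O$ (the topology of the uniformity with base the sets $U_{R,r}$). Let $d_{GH}(M,x;N,y)=\inf_d\max\{d(x,y),H_d(M,N)\}\in[0,\infty]$, where $d$ runs over the admissible metrics on $M\sqcup N$ and $H_d$ is the Hausdorff distance. Let $d_{\mathrm{Lip}}(M,x;N,y)\in[0,\infty]$ be the infimum of all $r\ge 0$ for which there is a bijection $\phi:M\to N$ with $\phi(x)=y$ and $e^{-r}d_M(u,v)\le d_N(\phi(u),\phi(v))\le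 e^{r}d_M(u,v)$ for all $u,v\in M$. Let $E_{GH}$ be the relation $d_{GH}<\infty$ on $\mathcal M_*$, let $E_{\mathrm{Lip}}$ be the relation given by the existence of a pointed bi-Lipschitz bijection, and let the quasi-isometry relation $E_{QI}$ be the smallest equivalence relation on $\mathcal M_*$ containing $E_{GH}\cup E_{\mathrm{Lip}}$. Finally, let $d_{QI}(P,Q)$ be the infimum of the sums $$\sum_{i=1}^k \bigl(d_{GH}(P_{2i-2},P_{2i-1})+d_{\mathrm{Lip}}(P_{2i-1},P_{2i})\bigr)$$ over all $k\ge1$ and all finite sequences $P=P_0,P_1,\dots,P_{2k}=Q$ in $\mathcal M_*$, and let $B_{QI}(P;r)=\{Q\in\mathcal M_* : d_{QI}(P,Q)<r\}$. Then every equivalence class of $E_{QI}$ is meager in $\mathcal M_*$. Moreover, for every $[M,x]\in\mathcal M_*$ and every $r>0$, the ball $B_{QI}(M,x;r)$ is nowhere dense in $\mathcal M_*$. -/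

import Mathlib

open scoped ENNReal NNReal

noncomputable section

/-- A pointed proper metric space `(M, x)`: every closed ball is compact. A proper metric space has
at most the cardinality of the continuum, so every pointed proper metric space is isometric to one
with carrier in `Type`. -/
structure PointedProperSpace : Type 1 where
  carrier : Type
  [metric : MetricSpace carrier]
  [proper : ProperSpace carrier]
  pt : carrier

namespace PointedProperSpace

attribute [instance] PointedProperSpace.metric PointedProperSpace.proper

/-- Pointed isometry: a surjective isometry carrying base point to base point. -/
instance isometrySetoid : Setoid PointedProperSpace where
  r A B := ∃ e : A.carrier ≃ᵢ B.carrier, e A.pt = B.pt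
  iseqv :=
    { refl := fun A => ⟨IsometryEquiv.refl A.carrier, rfl⟩
      symm := fun {A B} ⟨e, he⟩ => ⟨e.symm, by rw [← he, e.symm_apply_apply]⟩
      trans := fun {A B C} ⟨e, he⟩ ⟨f, hf⟩ => ⟨e.trans f, by
        rw [IsometryEquiv.trans_apply, he, hf]⟩ }

/-- A metric on `M ⊔ N` is admissible if it restricts to the given metrics on `M` and on `N`. -/
def IsAdmissible {M N : Type} [MetricSpace M] [MetricSpace N] (d : MetricSpace (M ⊕ N)) : Prop :=
  (∀ u u' : M, d.dist (Sum.inl u) (Sum.inl u') = dist u u') ∧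
    (∀ v v' : N, d.dist (Sum.inr v) (Sum.inr v') = dist v v')

/-- `H_{d,R}(M,x;N,y)` for subsets `M`, `N` of a metric space `(X, d)`: the maximum of
the suprema of `d(u,N)` over `u ∈ B_M(x,R)` and of `d(v,M)` over `v ∈ B_N(y,R)`. -/
def localHausdorff {X : Type} [MetricSpace X] (R : ℝ) (M : Set X) (x : X) (N : Set X) (y : X) :
    ℝ≥0∞ :=
  max (⨆ u ∈ M ∩ Metric.ball x R, Metric.infEDist u N)
    (⨆ v ∈ N ∩ Metric.ball y R, Metric.infEDist v M)

/-- The entourage `U_{R,r}` at the level of pointed proper metric spaces: there is an admissible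
metric `d` on `M ⊔ N` with `max {d(x,y), H_{d,R}(M,x;N,y)} < r`. -/
def Close (R r : ℝ) (A B : PointedProperSpace) : Prop :=
  ∃ d : MetricSpace (A.carrier ⊕ B.carrier), IsAdmissible d ∧
    letI := d
    max (edist (Sum.inl A.pt : A.carrier ⊕ B.carrier) (Sum.inr B.pt))
      (localHausdorff R (Set.range (Sum.inl : A.carrier → A.carrier ⊕ B.carrier)) (Sum.inl A.pt)
        (Set.range (Sum.inr : B.carrier → A.carrier ⊕ B.carrier)) (Sum.inr B.pt))
      < ENNReal.ofReal r

/-- The pointed Gromov-Hausdorff distance: the infimum over the admissible metrics `d` on `M ⊔ N`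
of `max {d(x,y), H_d(M,N)}`. -/
def ghDist (A B : PointedProperSpace) : ℝ≥0∞ :=
  ⨅ (d : MetricSpace (A.carrier ⊕ B.carrier)) (_ : IsAdmissible d),
    letI := d
    max (edist (Sum.inl A.pt : A.carrier ⊕ B.carrier) (Sum.inr B.pt))
      (Metric.hausdorffEDist (Set.range (Sum.inl : A.carrier → A.carrier ⊕ B.carrier))
        (Set.range (Sum.inr : B.carrier → A.carrier ⊕ B.carrier)))

/-- The Lipschitz distance: the infimum of the `r ≥ 0` such that some pointed bijection `φ`
satisfies `e⁻ʳ d(u,v) ≤ d(φ u, φ v) ≤ eʳ d(u,v)`; it is `∞` if there is no such `φ`. -/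
def lipDist (A B : PointedProperSpace) : ℝ≥0∞ :=
  ⨅ (r : ℝ≥0) (_ : ∃ φ : A.carrier ≃ B.carrier, φ A.pt = B.pt ∧
      ∀ u v : A.carrier, Real.exp (-(r : ℝ)) * dist u v ≤ dist (φ u) (φ v) ∧
        dist (φ u) (φ v) ≤ Real.exp r * dist u v), (r : ℝ≥0∞)

/-- Existence of a pointed bi-Lipschitz bijection. -/
def LipEquivalent (A B : PointedProperSpace) : Prop :=
  ∃ φ : A.carrier ≃ B.carrier, φ A.pt = B.pt ∧
    ∃ K K' : ℝ≥0, LipschitzWith K φ ∧ LipschitzWith K' φ.symm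

theorem exists_transport {M N M' N' : Type} [MetricSpace M] [MetricSpace N] [MetricSpace M']
    [MetricSpace N'] (e : M ≃ᵢ M') (f : N ≃ᵢ N') (d : MetricSpace (M ⊕ N))
    (hd : IsAdmissible d) :
    ∃ d' : MetricSpace (M' ⊕ N'), IsAdmissible d' ∧
      @Isometry (M ⊕ N) (M' ⊕ N') d.toPseudoMetricSpace.toPseudoEMetricSpace
        d'.toPseudoMetricSpace.toPseudoEMetricSpace (Sum.map e f) := by
  have hinj : Function.Injective (Sum.map e.symm f.symm) :=
    Sum.map_injective.2 ⟨e.symm.injective, f.symm.injective⟩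
  refine ⟨MetricSpace.induced (Sum.map e.symm f.symm) hinj d, ⟨fun u u' => ?_, fun v v' => ?_⟩, ?_⟩
  · exact (hd.1 (e.symm u) (e.symm u')).trans (e.symm.isometry.dist_eq u u')
  · exact (hd.2 (f.symm v) (f.symm v')).trans (f.symm.isometry.dist_eq v v')
  · let _ := d
    let d' := MetricSpace.induced (Sum.map e.symm f.symm) hinj d
    refine Isometry.of_dist_eq fun a b => ?_
    change dist (Sum.map e.symm f.symm (Sum.map e f a)) (Sum.map e.symm f.symm (Sum.map e f b)) = _
    have h : ∀ c, Sum.map e.symm f.symm (Sum.map e f c) = c := by rintro (c | c) <;> simp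
    rw [h, h]

theorem range_inl_map {M N M' N' : Type} (e : M → M') (f : N → N') (he : Function.Surjective e) :
    Set.range (Sum.inl : M' → M' ⊕ N') = Sum.map e f '' Set.range (Sum.inl : M → M ⊕ N) := by
  ext z
  constructor
  · rintro ⟨w, rfl⟩
    obtain ⟨u, rfl⟩ := he w
    exact ⟨_, ⟨u, rfl⟩, rfl⟩
  · rintro ⟨_, ⟨u, rfl⟩, rfl⟩
    exact ⟨e u, rfl⟩

theorem range_inr_map {M N M' N' : Type} (e : M → M') (f : N → N') (hf : Function.Surjective f) :
    Set.range (Sum.inr : N' → M' ⊕ N') = Sum.map e f '' Set.range (Sum.inr : N → M ⊕ N) := by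
  ext z
  constructor
  · rintro ⟨w, rfl⟩
    obtain ⟨u, rfl⟩ := hf w
    exact ⟨_, ⟨u, rfl⟩, rfl⟩
  · rintro ⟨_, ⟨u, rfl⟩, rfl⟩
    exact ⟨f u, rfl⟩

theorem localHausdorff_image {X Y : Type} [MetricSpace X] [MetricSpace Y] {g : X → Y}
    (hg : Isometry g) (R : ℝ) (M : Set X) (x : X) (N : Set X) (y : X) :
    localHausdorff R (g '' M) (g x) (g '' N) (g y) = localHausdorff R M x N y := by
  have h : ∀ (S : Set X) (z : X), g '' S ∩ Metric.ball (g z) R = g '' (S ∩ Metric.ball z R) := by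
    intro S z
    rw [← hg.preimage_ball, Set.image_inter_preimage]
  simp only [localHausdorff, h, iSup_image, Metric.infEDist_image hg]

theorem Close.congr {R r : ℝ} {A B A' B' : PointedProperSpace} (hA : A ≈ A') (hB : B ≈ B')
    (h : Close R r A B) : Close R r A' B' := by
  obtain ⟨e, he⟩ := hA
  obtain ⟨f, hf⟩ := hB
  obtain ⟨d, hd, hlt⟩ := h
  obtain ⟨d', hd', hi⟩ := exists_transport e f d hd
  refine ⟨d', hd', ?_⟩
  let _ := d
  let _ := d'
  have hx : (Sum.inl A'.pt : A'.carrier ⊕ B'.carrier) = Sum.map e f (Sum.inl A.pt) := by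
    simp [he]
  have hy : (Sum.inr B'.pt : A'.carrier ⊕ B'.carrier) = Sum.map e f (Sum.inr B.pt) := by
    simp [hf]
  rw [hx, hy, range_inl_map e f e.surjective, range_inr_map e f f.surjective, hi.edist_eq,
    localHausdorff_image hi]
  exact hlt

theorem ghDist_le_of_equiv {A B A' B' : PointedProperSpace} (hA : A ≈ A') (hB : B ≈ B') :
    ghDist A' B' ≤ ghDist A B := by
  obtain ⟨e, he⟩ := hA
  obtain ⟨f, hf⟩ := hB
  refine le_iInf₂ fun d hd => ?_
  obtain ⟨d', hd', hi⟩ := exists_transport e f d hd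
  refine (iInf₂_le d' hd').trans ?_
  let _ := d
  let _ := d'
  have hx : (Sum.inl A'.pt : A'.carrier ⊕ B'.carrier) = Sum.map e f (Sum.inl A.pt) := by
    simp [he]
  have hy : (Sum.inr B'.pt : A'.carrier ⊕ B'.carrier) = Sum.map e f (Sum.inr B.pt) := by
    simp [hf]
  rw [hx, hy, range_inl_map e f e.surjective, range_inr_map e f f.surjective, hi.edist_eq,
    Metric.hausdorffEDist_image hi]

theorem lipDist_le_of_equiv {A B A' B' : PointedProperSpace} (hA : A ≈ A') (hB : B ≈ B') :
    lipDist A' B' ≤ lipDist A B := by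
  obtain ⟨e, he⟩ := hA
  obtain ⟨f, hf⟩ := hB
  refine le_iInf₂ fun r hr => ?_
  obtain ⟨φ, hφ, h⟩ := hr
  refine iInf₂_le r ⟨(e.symm.toEquiv.trans φ).trans f.toEquiv, ?_, fun u v => ?_⟩
  · simp [← he, hφ, hf]
  · have := h (e.symm u) (e.symm v)
    rw [e.symm.isometry.dist_eq] at this
    simpa [f.isometry.dist_eq] using this

theorem LipEquivalent.congr {A B A' B' : PointedProperSpace} (hA : A ≈ A') (hB : B ≈ B')
    (h : LipEquivalent A B) : LipEquivalent A' B' := by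
  obtain ⟨e, he⟩ := hA
  obtain ⟨f, hf⟩ := hB
  obtain ⟨φ, hφ, K, K', hK, hK'⟩ := h
  refine ⟨(e.symm.toEquiv.trans φ).trans f.toEquiv, ?_, 1 * (K * 1), 1 * (K' * 1), ?_, ?_⟩
  · simp [← he, hφ, hf]
  · exact f.isometry.lipschitz.comp (hK.comp e.symm.isometry.lipschitz)
  · exact e.isometry.lipschitz.comp (hK'.comp f.symm.isometry.lipschitz)

end PointedProperSpace

/-- The set `M_*` of pointed isometry classes `[M, x]` of pointed proper metric spaces. -/
def GromovSpace : Type 1 := Quotient PointedProperSpace.isometrySetoid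

namespace GromovSpace

open PointedProperSpace

/-- The set `U_{R,r}` of pairs of elements of `M_*`. -/
def Entourage (R r : ℝ) : GromovSpace → GromovSpace → Prop :=
  Quotient.lift₂ (Close R r) fun _ _ _ _ hA hB =>
    propext ⟨Close.congr hA hB, Close.congr (Setoid.symm hA) (Setoid.symm hB)⟩

theorem Entourage.mono {R R' r r' : ℝ} (hR : R' ≤ R) (hr : r ≤ r') {P Q : GromovSpace}
    (h : Entourage R r P Q) : Entourage R' r' P Q := by
  induction P using Quotient.inductionOn
  induction Q using Quotient.inductionOn
  obtain ⟨d, hd, hlt⟩ := h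
  refine ⟨d, hd, lt_of_le_of_lt ?_ (hlt.trans_le (ENNReal.ofReal_le_ofReal hr))⟩
  let _ := d
  refine max_le_max le_rfl (max_le_max ?_ ?_) <;>
    exact biSup_mono fun u hu => ⟨hu.1, Metric.ball_subset_ball hR hu.2⟩

/-- The topology of the Gromov space, that of the uniformity with base the `U_{R,r}`, `R, r > 0`:
a set is open iff with each point `P` it contains some `U_{R,r}(P)`. -/
instance topology : TopologicalSpace GromovSpace where
  IsOpen O := ∀ P ∈ O, ∃ R > 0, ∃ r > 0, ∀ Q, Entourage R r P Q → Q ∈ O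
  isOpen_univ := fun _ _ => ⟨1, one_pos, 1, one_pos, fun _ _ => trivial⟩
  isOpen_inter := by
    rintro O O' hO hO' P ⟨hP, hP'⟩
    obtain ⟨R, hR, r, hr, h⟩ := hO P hP
    obtain ⟨R', hR', r', hr', h'⟩ := hO' P hP'
    exact ⟨max R R', lt_max_of_lt_left hR, min r r', lt_min hr hr', fun Q hQ =>
      ⟨h Q (hQ.mono (le_max_left _ _) (min_le_left _ _)),
        h' Q (hQ.mono (le_max_right _ _) (min_le_right _ _))⟩⟩
  isOpen_sUnion := by
    rintro 𝒪 h𝒪 P ⟨O, hO, hP⟩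
    obtain ⟨R, hR, r, hr, h⟩ := h𝒪 O hO P hP
    exact ⟨R, hR, r, hr, fun Q hQ => ⟨O, hO, h Q hQ⟩⟩

/-- The pointed Gromov-Hausdorff distance `d_GH` on `M_*`, with values in `[0,∞]`. -/
def dGH : GromovSpace → GromovSpace → ℝ≥0∞ :=
  Quotient.lift₂ ghDist fun _ _ _ _ hA hB =>
    le_antisymm (ghDist_le_of_equiv (Setoid.symm hA) (Setoid.symm hB)) (ghDist_le_of_equiv hA hB)

/-- The Lipschitz distance `d_Lip` on `M_*`, with values in `[0,∞]`. -/
def dLip : GromovSpace → GromovSpace → ℝ≥0∞ :=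
  Quotient.lift₂ lipDist fun _ _ _ _ hA hB =>
    le_antisymm (lipDist_le_of_equiv (Setoid.symm hA) (Setoid.symm hB)) (lipDist_le_of_equiv hA hB)

/-- The relation `E_GH` of being at finite Gromov-Hausdorff distance. -/
def EGH (P Q : GromovSpace) : Prop := dGH P Q < ∞

/-- The Lipschitz relation `E_Lip`: existence of a pointed bi-Lipschitz bijection. -/
def ELip : GromovSpace → GromovSpace → Prop :=
  Quotient.lift₂ LipEquivalent fun _ _ _ _ hA hB =>
    propext ⟨LipEquivalent.congr hA hB, LipEquivalent.congr (Setoid.symm hA) (Setoid.symm hB)⟩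

/-- The quasi-isometry relation `E_QI`: the smallest equivalence relation on `M_*` that contains
`E_GH ∪ E_Lip`. -/
def EQI : Setoid GromovSpace := Relation.EqvGen.setoid fun P Q => EGH P Q ∨ ELip P Q

/-- The quasi-isometric distance `d_QI(P,Q)`: the infimum of the sums
`∑_{i=1}^k d_GH(c_{2i-2}, c_{2i-1}) + d_Lip(c_{2i-1}, c_{2i})` over all `k ≥ 1` and all finite
sequences `c_0 = P, …, c_{2k} = Q` in `M_*`. This is the largest distance function on `M_*` with
values in `[0,∞]` that is at most `d_GH` and at most `d_Lip`. -/
def dQI (P Q : GromovSpace) : ℝ≥0∞ :=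
  ⨅ (k : ℕ) (_ : 1 ≤ k) (c : ℕ → GromovSpace) (_ : c 0 = P) (_ : c (2 * k) = Q),
    ∑ i ∈ Finset.range k, (dGH (c (2 * i)) (c (2 * i + 1)) + dLip (c (2 * i + 1)) (c (2 * i + 2)))

/-- The ball `B_QI(P; r)`. -/
def ballQI (P : GromovSpace) (r : ℝ) : Set GromovSpace := {Q | dQI P Q < ENNReal.ofReal r}

end GromovSpace

end

/-! Being close to `[M,x]` in `dQI` bounds how many separated points a ball about the base point can
hold, while arbitrarily small perturbations in the Gromov topology can place any number of points
far away. `CoarseEmb` is a one-sided coarse control that composes with additive parameters and is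
implied by small `ghDist` or small `lipDist`; so `ballQI P r` lies in `coarseBall P r`, and an `EQI`
class in a countable union of coarse balls. Fix `a` and let `s = eᵃ + 2aeᵃ`. By properness, the
image ball of radius `eᵃT + 2aeᵃ` in `M` has at most some `c T` points more than 1 apart, so no
space in `coarseBall P a` is `Crowded s T (c T)`, for any `T`. Crowding is an open condition
(`Crowded.exists_forall_close`), and the union over `T` of these open sets is dense: attaching `c (D
+ 1) + 1` points at a large distance `D` crowds a space without leaving a given entourage
(`close_attachPoints`). Hence coarse balls are nowhere dense. -/

namespace PointedProperSpace

/-! ### Coarse embeddings -/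

/-- There is a map from `B` to `A` that contracts distances at most by the factor `eᵃ`, and moves
points away from the base point at most by that factor, both up to the additive constant
`2 a eᵃ`. -/
def CoarseEmb (a : ℝ≥0) (A B : PointedProperSpace) : Prop :=
  ∃ g : B.carrier → A.carrier,
    (∀ v v', dist v v' ≤ Real.exp a * dist (g v) (g v') + 2 * a * Real.exp a) ∧
      ∀ v, dist (g v) A.pt ≤ Real.exp a * dist v B.pt + 2 * a * Real.exp a

theorem CoarseEmb.mono {a b : ℝ≥0} (hab : a ≤ b) {A B : PointedProperSpace}
    (h : CoarseEmb a A B) : CoarseEmb b A B := by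
  obtain ⟨g, h₁, h₂⟩ := h
  have hab' : (a : ℝ) ≤ b := hab
  exact ⟨g, fun v v' => (h₁ v v').trans (by gcongr), fun v => (h₂ v).trans (by gcongr)⟩

/-- The factor `eᵃ` in the additive error `2aeᵃ` absorbs the stretching of one error by the other
map, so that parameters simply add under composition. -/
theorem add_const_le (a b : ℝ≥0) :
    Real.exp b * (2 * a * Real.exp a) + 2 * b * Real.exp b ≤
      2 * (a + b : ℝ≥0) * Real.exp (a + b : ℝ≥0) := by
  have h : Real.exp b ≤ Real.exp a * Real.exp b :=
    le_mul_of_one_le_left (Real.exp_pos _).le (Real.one_le_exp a.2)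
  have hb := mul_le_mul_of_nonneg_left h (by positivity : (0 : ℝ) ≤ 2 * b)
  push_cast
  rw [Real.exp_add]
  linarith

theorem CoarseEmb.trans {a b : ℝ≥0} {A B C : PointedProperSpace} (hAB : CoarseEmb a A B)
    (hBC : CoarseEmb b B C) : CoarseEmb (a + b) A C := by
  obtain ⟨g, g₁, g₂⟩ := hAB
  obtain ⟨f, f₁, f₂⟩ := hBC
  have hexp : Real.exp (a + b : ℝ≥0) = Real.exp a * Real.exp b := by
    rw [NNReal.coe_add, Real.exp_add]
  refine ⟨g ∘ f, fun v v' => ?_, fun v => ?_⟩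
  · have h := mul_le_mul_of_nonneg_left (g₁ (f v) (f v')) (Real.exp_pos b).le
    have h' := f₁ v v'
    have hc := add_const_le a b
    have e : Real.exp (a + b : ℝ≥0) * dist (g (f v)) (g (f v')) =
      Real.exp b * (Real.exp a * dist (g (f v)) (g (f v'))) := by rw [hexp]; ring
    simp only [Function.comp_apply]
    linarith
  · have h := mul_le_mul_of_nonneg_left (f₂ v) (Real.exp_pos a).le
    have h' := g₂ (f v)
    have hc := add_const_le b a
    rw [add_comm b a] at hc
    have e : Real.exp (a + b : ℝ≥0) * dist v C.pt =
      Real.exp a * (Real.exp b * dist v C.pt) := by rw [hexp]; ring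
    simp only [Function.comp_apply]
    linarith

theorem CoarseEmb.of_equiv {A B : PointedProperSpace} (h : A ≈ B) : CoarseEmb 0 A B := by
  obtain ⟨e, he⟩ := Setoid.symm h
  exact ⟨e, fun v v' => by simp [e.isometry.dist_eq],
    fun v => by simp [← he, e.isometry.dist_eq]⟩

/-- Sending each point of `B` to a point of `A` less than `a` away in the glued metric changes
distances by at most `2a`; the base points are also less than `a` apart. -/
theorem CoarseEmb.of_ghDist_lt {a : ℝ≥0} {A B : PointedProperSpace} (h : ghDist A B < a) :
    CoarseEmb a A B := by
  simp only [ghDist, iInf_lt_iff] at h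
  obtain ⟨d, hd, hlt⟩ := h
  let _ := d
  obtain ⟨hpt, hH⟩ := max_lt_iff.1 hlt
  have hpt' : dist (Sum.inl A.pt : A.carrier ⊕ B.carrier) (Sum.inr B.pt) < a := by
    rw [edist_nndist] at hpt
    exact_mod_cast hpt
  have hex : ∀ v : B.carrier, ∃ u : A.carrier,
      dist (Sum.inr v : A.carrier ⊕ B.carrier) (Sum.inl u) < a := by
    intro v
    rw [Metric.hausdorffEDist_comm] at hH
    obtain ⟨_, ⟨u, rfl⟩, hu⟩ := Metric.exists_edist_lt_of_hausdorffEDist_lt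
      (Set.mem_range_self v) hH
    refine ⟨u, ?_⟩
    rw [edist_nndist] at hu
    exact_mod_cast hu
  choose g hg using hex
  have ha : (1 : ℝ) ≤ Real.exp a := Real.one_le_exp a.2
  have hC : (2 * a : ℝ) ≤ 2 * a * Real.exp a := le_mul_of_one_le_right (by positivity) ha
  refine ⟨g, fun v v' => ?_, fun v => ?_⟩
  · have h₁ := dist_triangle4 (Sum.inr v : A.carrier ⊕ B.carrier) (Sum.inl (g v))
      (Sum.inl (g v')) (Sum.inr v')
    rw [dist_comm (Sum.inl (g v') : A.carrier ⊕ B.carrier)] at h₁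
    have e₁ : dist (Sum.inr v : A.carrier ⊕ B.carrier) (Sum.inr v') = dist v v' := hd.2 v v'
    have e₂ : dist (Sum.inl (g v) : A.carrier ⊕ B.carrier) (Sum.inl (g v')) =
      dist (g v) (g v') := hd.1 _ _
    have := le_mul_of_one_le_left (dist_nonneg (x := g v) (y := g v')) ha
    linarith [hg v, hg v']
  · have h₁ := dist_triangle4 (Sum.inl (g v) : A.carrier ⊕ B.carrier) (Sum.inr v)
      (Sum.inr B.pt) (Sum.inl A.pt)
    rw [dist_comm (Sum.inl (g v) : A.carrier ⊕ B.carrier) (Sum.inr v),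
      dist_comm (Sum.inr B.pt : A.carrier ⊕ B.carrier)] at h₁
    have e₁ : dist (Sum.inr v : A.carrier ⊕ B.carrier) (Sum.inr B.pt) = dist v B.pt := hd.2 _ _
    have e₂ : dist (Sum.inl (g v) : A.carrier ⊕ B.carrier) (Sum.inl A.pt) =
      dist (g v) A.pt := hd.1 _ _
    have := le_mul_of_one_le_left (dist_nonneg (x := v) (y := B.pt)) ha
    linarith [hg v]

theorem CoarseEmb.of_bilipschitz {r : ℝ≥0} {A B : PointedProperSpace} (φ : A.carrier ≃ B.carrier)
    (hφ : φ A.pt = B.pt) (h : ∀ u v : A.carrier, Real.exp (-(r : ℝ)) * dist u v ≤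
      dist (φ u) (φ v) ∧ dist (φ u) (φ v) ≤ Real.exp r * dist u v) : CoarseEmb r A B := by
  have hC : (0 : ℝ) ≤ 2 * r * Real.exp r := by positivity
  refine ⟨φ.symm, fun v v' => ?_, fun v => ?_⟩
  · have := (h (φ.symm v) (φ.symm v')).2
    simp only [Equiv.apply_symm_apply] at this
    linarith
  · have := mul_le_mul_of_nonneg_left (h (φ.symm v) A.pt).1 (Real.exp_pos r).le
    rw [← mul_assoc, ← Real.exp_add, add_neg_cancel, Real.exp_zero, one_mul, hφ,
      Equiv.apply_symm_apply] at this
    linarith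

theorem CoarseEmb.of_lipDist_lt {a : ℝ≥0} {A B : PointedProperSpace} (h : lipDist A B < a) :
    CoarseEmb a A B := by
  simp only [lipDist, iInf_lt_iff] at h
  obtain ⟨r, ⟨φ, hφ, hr⟩, hlt⟩ := h
  exact (of_bilipschitz φ hφ hr).mono (by exact_mod_cast hlt.le)

theorem ghDist_comm_le (A B : PointedProperSpace) : ghDist B A ≤ ghDist A B := by
  refine le_iInf₂ fun d hd => ?_
  let d' : MetricSpace (B.carrier ⊕ A.carrier) :=
    MetricSpace.induced Sum.swap Sum.swap_leftInverse.injective d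
  refine (iInf₂_le d' ⟨hd.2, hd.1⟩).trans ?_
  let _ := d
  let _ := d'
  have hi : Isometry (Sum.swap : B.carrier ⊕ A.carrier → A.carrier ⊕ B.carrier) :=
    Isometry.of_dist_eq fun _ _ => rfl
  rw [← hi.edist_eq, ← Metric.hausdorffEDist_image hi, ← Set.range_comp, ← Set.range_comp,
    edist_comm, Metric.hausdorffEDist_comm]
  exact le_rfl

theorem LipEquivalent.exists_coarseEmb {A B : PointedProperSpace} (h : LipEquivalent A B) :
    ∃ a, CoarseEmb a A B ∧ CoarseEmb a B A := by
  obtain ⟨φ, hφ, K, K', hK, hK'⟩ := h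
  obtain ⟨r, hr⟩ : ∃ r : ℝ≥0, (max K K' : ℝ≥0) ≤ Real.exp r := by
    -- `t + 1 ≤ eᵗ` lets the Lipschitz constant serve as its own exponent.
    refine ⟨max K K', ?_⟩
    linarith [Real.add_one_le_exp (max K K' : ℝ≥0)]
  have hKr : (K : ℝ) ≤ Real.exp r := le_trans (by exact_mod_cast le_max_left K K') hr
  have hKr' : (K' : ℝ) ≤ Real.exp r := le_trans (by exact_mod_cast le_max_right K K') hr
  have h₁ : ∀ u v : A.carrier, dist (φ u) (φ v) ≤ Real.exp r * dist u v := fun u v =>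
    (hK.dist_le_mul u v).trans (by gcongr)
  have h₂ : ∀ u v : B.carrier, dist (φ.symm u) (φ.symm v) ≤ Real.exp r * dist u v := fun u v =>
    (hK'.dist_le_mul u v).trans (by gcongr)
  have inv : ∀ {s t : ℝ}, s ≤ Real.exp r * t → Real.exp (-(r : ℝ)) * s ≤ t := by
    intro s t hst
    rw [Real.exp_neg, inv_mul_le_iff₀ (Real.exp_pos _)]
    exact hst
  refine ⟨r, .of_bilipschitz φ hφ fun u v => ⟨inv ?_, h₁ u v⟩,
    .of_bilipschitz φ.symm (by simp [← hφ]) fun u v => ⟨inv ?_, h₂ u v⟩⟩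
  · simpa using h₂ (φ u) (φ v)
  · simpa using h₁ (φ.symm u) (φ.symm v)

/-! ### Counting separated points in balls -/

/-- The open ball of radius `T` about the base point contains more than `c` points at pairwise
distances greater than `s`. -/
def Crowded (s T : ℝ) (c : ℕ) (A : PointedProperSpace) : Prop :=
  ∃ p : Fin (c + 1) → A.carrier, (∀ i, dist (p i) A.pt < T) ∧
    Pairwise fun i j => s < dist (p i) (p j)

/-- A closed ball is compact, hence covered by finitely many balls of radius `s / 2`; by pigeonhole
two of too many points share one, and are less than `s` apart. -/
theorem exists_not_crowded (A : PointedProperSpace) {s : ℝ} (hs : 0 < s) (T : ℝ) :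
    ∃ c, ¬ Crowded s T c A := by
  obtain ⟨t, -, ht, hcov⟩ :=
    (isCompact_closedBall A.pt T).finite_cover_balls (half_pos hs)
  refine ⟨ht.toFinset.card, ?_⟩
  rintro ⟨p, hp, hsep⟩
  have hex : ∀ i, ∃ z ∈ ht.toFinset, dist (p i) z < s / 2 := fun i => by
    simpa using hcov (Metric.mem_closedBall.2 (hp i).le)
  choose z hz hd using hex
  obtain ⟨i, -, j, -, hij, he⟩ := Finset.exists_ne_map_eq_of_card_lt_of_maps_to
    (s := Finset.univ) (by simp) (fun i _ => hz i)
  have h₁ := hd i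
  have h₂ := hd j
  rw [← he] at h₂
  linarith [hsep hij, dist_triangle_right (p i) (p j) (z i)]

theorem Crowded.of_coarseEmb {a : ℝ≥0} {T : ℝ} {c : ℕ} {A B : PointedProperSpace}
    (h : CoarseEmb a A B) (hB : Crowded (Real.exp a + 2 * a * Real.exp a) T c B) :
    Crowded 1 (Real.exp a * T + 2 * a * Real.exp a) c A := by
  obtain ⟨g, h₁, h₂⟩ := h
  obtain ⟨p, hp, hsep⟩ := hB
  refine ⟨g ∘ p, fun i => (h₂ (p i)).trans_lt ?_, fun i j hij => ?_⟩
  · have := mul_lt_mul_of_pos_left (hp i) (Real.exp_pos a)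
    linarith
  · refine lt_of_mul_lt_mul_left ?_ (Real.exp_pos a).le
    have := hsep hij
    have := h₁ (p i) (p j)
    simp only [Function.comp_apply]
    linarith

/-- Crowding consists of finitely many strict inequalities, so it survives replacing each point by
one less than `r` away, with a loss of `2 * r` in each. -/
theorem Crowded.exists_forall_close {s T : ℝ} {c : ℕ} {A : PointedProperSpace}
    (h : Crowded s T c A) : ∃ R > 0, ∃ r > 0, ∀ B, Close R r A B → Crowded s T c B := by
  obtain ⟨p, hp, hsep⟩ := h
  obtain ⟨r, hr, hrT, hrs⟩ : ∃ r > 0, (∀ i, dist (p i) A.pt + 2 * r < T) ∧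
      ∀ i j, i ≠ j → s + 2 * r < dist (p i) (p j) := by
    have e : ∀ᶠ r : ℝ in nhdsWithin 0 (Set.Ioi 0), (∀ i, dist (p i) A.pt + 2 * r < T) ∧
        ∀ i j, i ≠ j → s + 2 * r < dist (p i) (p j) := by
      refine Filter.Eventually.filter_mono nhdsWithin_le_nhds (Filter.Eventually.and ?_ ?_)
      · refine Filter.eventually_all.2 fun i => ContinuousAt.eventually_lt (by fun_prop)
          (by fun_prop) (by simpa using hp i)
      · refine Filter.eventually_all.2 fun i => Filter.eventually_all.2 fun j => ?_
        by_cases hij : i = j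
        · simp [hij]
        · exact (ContinuousAt.eventually_lt (by fun_prop) (by fun_prop)
            (by simpa using hsep hij)).mono fun _ h _ => h
    obtain ⟨r, h, hr⟩ := (e.and self_mem_nhdsWithin).exists
    exact ⟨r, hr, h⟩
  have hT : 0 < T := dist_nonneg.trans_lt (hp 0)
  -- `R = T` suffices: all the points lie in the ball of radius `T`, where each has a partner in
  -- `B`.
  refine ⟨T, hT, r, hr, ?_⟩
  rintro B ⟨d, hd, hlt⟩
  let _ := d
  obtain ⟨hpt, hH⟩ := max_lt_iff.1 hlt
  rw [edist_lt_ofReal] at hpt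
  have hex : ∀ i, ∃ v : B.carrier,
      dist (Sum.inl (p i) : A.carrier ⊕ B.carrier) (Sum.inr v) < r := by
    intro i
    have hmem : (Sum.inl (p i) : A.carrier ⊕ B.carrier) ∈
        Set.range Sum.inl ∩ Metric.ball (Sum.inl A.pt) T :=
      ⟨⟨_, rfl⟩, Metric.mem_ball.2 ((hd.1 _ _).trans_lt (hp i))⟩
    have := (le_iSup₂ (f := fun u _ => Metric.infEDist u
      (Set.range (Sum.inr : B.carrier → A.carrier ⊕ B.carrier))) _ hmem).trans_lt
      ((le_max_left _ _).trans_lt hH)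
    obtain ⟨_, ⟨v, rfl⟩, hv⟩ := Metric.infEDist_lt_iff.1 this
    exact ⟨v, edist_lt_ofReal.1 hv⟩
  choose q hq using hex
  refine ⟨q, fun i => ?_, fun i j hij => ?_⟩
  · have h₁ := dist_triangle4 (Sum.inr (q i) : A.carrier ⊕ B.carrier) (Sum.inl (p i))
      (Sum.inl A.pt) (Sum.inr B.pt)
    rw [dist_comm (Sum.inr (q i) : A.carrier ⊕ B.carrier) (Sum.inl (p i))] at h₁
    have e₁ : dist (Sum.inr (q i) : A.carrier ⊕ B.carrier) (Sum.inr B.pt) = dist (q i) B.pt :=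
      hd.2 _ _
    have e₂ : dist (Sum.inl (p i) : A.carrier ⊕ B.carrier) (Sum.inl A.pt) = dist (p i) A.pt :=
      hd.1 _ _
    linarith [hq i, hrT i]
  · have h₁ := dist_triangle4 (Sum.inl (p i) : A.carrier ⊕ B.carrier) (Sum.inr (q i))
      (Sum.inr (q j)) (Sum.inl (p j))
    rw [dist_comm (Sum.inr (q j) : A.carrier ⊕ B.carrier) (Sum.inl (p j))] at h₁
    have e₁ : dist (Sum.inr (q i) : A.carrier ⊕ B.carrier) (Sum.inr (q j)) = dist (q i) (q j) :=
      hd.2 _ _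
    have e₂ : dist (Sum.inl (p i) : A.carrier ⊕ B.carrier) (Sum.inl (p j)) = dist (p i) (p j) :=
      hd.1 _ _
    linarith [hq i, hq j, hrs i j hij]

/-! ### Attaching distant points -/

/-- The subset of `A × ℝᵏ` (with the maximum metric) consisting of `A × {0}` and the points
`(A.pt, D eᵢ)`. -/
def hairSet (A : PointedProperSpace) (k : ℕ) (D : ℝ) : Set (A.carrier × (Fin k → ℝ)) :=
  {z | z.2 = 0} ∪ Set.range fun i => (A.pt, Pi.single i D)

/-- The space `A` with `k` points attached at distance `D` from the base point. -/
def attachPoints (A : PointedProperSpace) (k : ℕ) (D : ℝ) : PointedProperSpace where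
  carrier := hairSet A k D
  proper := by
    have hclosed : IsClosed (hairSet A k D) :=
      (isClosed_eq continuous_snd continuous_const).union (Set.finite_range _).isClosed
    exact ProperSpace.of_isClosed hclosed
  pt := ⟨(A.pt, 0), Or.inl rfl⟩

theorem crowded_attachPoints (A : PointedProperSpace) (c : ℕ) {s D : ℝ} (hD : 0 < D)
    (hs : s < D) : Crowded s (D + 1) c (attachPoints A (c + 1) D) := by
  refine ⟨fun i => ⟨(A.pt, Pi.single i D), Or.inr ⟨i, rfl⟩⟩, fun i => ?_, fun i j hij => ?_⟩
  · change dist (A.pt, (Pi.single i D : Fin (c + 1) → ℝ)) (A.pt, 0) < D + 1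
    rw [Prod.dist_eq, dist_self, dist_zero_right, Pi.norm_single, Real.norm_of_nonneg hD.le]
    exact max_lt (by linarith) (by linarith)
  · change s < dist (A.pt, (Pi.single i D : Fin (c + 1) → ℝ)) (A.pt, Pi.single j D)
    refine hs.trans_le (le_trans ?_ (le_max_right _ _))
    refine le_trans ?_ (dist_le_pi_dist _ _ i)
    simp [Pi.single_eq_of_ne hij, le_abs_self]

theorem close_attachPoints (A : PointedProperSpace) (k : ℕ) {R r D : ℝ} (hr : 0 < r)
    (hR : R ≤ D) : Close R r A (attachPoints A k D) := by
  -- The two spaces sit at heights `0` and `r / 2` in a product; the gap keeps the union disjoint,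
  -- so the induced distance is a genuine metric.
  let f : A.carrier ⊕ (attachPoints A k D).carrier → (A.carrier × (Fin k → ℝ)) × ℝ :=
    Sum.elim (fun u => ((u, 0), 0)) (fun w => (w.1, r / 2))
  have hf : Function.Injective f := by
    refine Function.Injective.sumElim (fun u u' h => by simpa using h)
      (fun w w' h => Subtype.ext (congrArg Prod.fst h)) fun u w h => ?_
    have := congrArg Prod.snd h
    simp only at this
    linarith
  let d : MetricSpace (A.carrier ⊕ (attachPoints A k D).carrier) :=
    MetricSpace.induced f hf inferInstance
  have hd : ∀ a b, d.dist a b = dist (f a) (f b) := fun _ _ => rfl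
  refine ⟨d, ⟨fun u u' => ?_, fun v v' => ?_⟩, ?_⟩
  · simp [hd, f, Prod.dist_eq]
  · rw [hd]
    change max (dist v.1 v'.1) (dist (r / 2) (r / 2)) = dist v.1 v'.1
    simp
  · have hlink : ∀ (u : A.carrier) (h : ((u, 0) : A.carrier × (Fin k → ℝ)) ∈ hairSet A k D),
        edist (Sum.inl u : A.carrier ⊕ (attachPoints A k D).carrier) (Sum.inr ⟨(u, 0), h⟩) ≤
          ENNReal.ofReal (r / 2) := by
      intro u h
      rw [edist_le_ofReal (half_pos hr).le]
      change max (dist ((u, 0) : A.carrier × (Fin k → ℝ)) (u, 0)) (dist 0 (r / 2)) ≤ r / 2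
      simp [Real.dist_eq, abs_of_pos (half_pos hr), (half_pos hr).le]
    refine lt_of_le_of_lt (max_le (hlink _ _) (max_le (iSup₂_le ?_) (iSup₂_le ?_)))
      ((ENNReal.ofReal_lt_ofReal_iff hr).2 (half_lt_self hr))
    · rintro _ ⟨⟨u, rfl⟩, -⟩
      exact (Metric.infEDist_le_edist_of_mem (Set.mem_range_self _)).trans (hlink u (Or.inl rfl))
    · rintro _ ⟨⟨⟨⟨u, t⟩, hw⟩, rfl⟩, hball⟩
      -- The attached points are at distance at least `D ≥ R` from the base point, so the open ball
      -- of radius `R` misses them.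
      have ht : t = 0 := by
        rcases hw with hw | ⟨i, hi⟩
        · exact hw
        · exfalso
          have hball' : dist ((u, t) : A.carrier × (Fin k → ℝ)) (A.pt, 0) < R :=
            (le_max_left _ _).trans_lt (Metric.mem_ball.1 hball)
          obtain ⟨rfl, rfl⟩ := Prod.mk.inj hi
          have h₁ := (le_max_right _ _).trans_lt hball'
          have h₂ : |D| < R := by simpa [Pi.norm_single] using h₁
          linarith [le_abs_self D]
      subst ht
      exact (Metric.infEDist_le_edist_of_mem (Set.mem_range_self u)).trans
        ((edist_comm _ _).trans_le (hlink u hw))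

end PointedProperSpace

/-! ### Coarse balls are nowhere dense -/

namespace GromovSpace

open PointedProperSpace

/-- The set of classes `Q` such that `CoarseEmb a` holds from `P` to `Q`. -/
def coarseBall (P : GromovSpace) (a : ℝ≥0) : Set GromovSpace :=
  {Q | CoarseEmb a P.out Q.out}

theorem mem_coarseBall_self (P : GromovSpace) : P ∈ coarseBall P 0 :=
  CoarseEmb.of_equiv (Setoid.refl _)

theorem mem_coarseBall_trans {P Q S : GromovSpace} {a b : ℝ≥0} (hQ : Q ∈ coarseBall P a)
    (hS : S ∈ coarseBall Q b) : S ∈ coarseBall P (a + b) :=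
  CoarseEmb.trans hQ hS

theorem dGH_eq_ghDist_out (P Q : GromovSpace) : dGH P Q = ghDist P.out Q.out := by
  conv_lhs => rw [← P.out_eq, ← Q.out_eq]
  rfl

theorem dLip_eq_lipDist_out (P Q : GromovSpace) : dLip P Q = lipDist P.out Q.out := by
  conv_lhs => rw [← P.out_eq, ← Q.out_eq]
  rfl

theorem ELip.lipEquivalent_out {P Q : GromovSpace} (h : ELip P Q) :
    LipEquivalent P.out Q.out := by
  rw [← P.out_eq, ← Q.out_eq] at h
  exact h

theorem isOpen_crowded (s T : ℝ) (c : ℕ) :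
    IsOpen {Q : GromovSpace | ∃ A, ⟦A⟧ = Q ∧ Crowded s T c A} := by
  rintro _ ⟨A, rfl, hA⟩
  obtain ⟨R, hR, r, hr, h⟩ := hA.exists_forall_close
  refine ⟨R, hR, r, hr, fun Q hQ => ?_⟩
  induction Q using Quotient.inductionOn with
  | h B => exact ⟨B, rfl, h B hQ⟩

theorem isNowhereDense_coarseBall (P : GromovSpace) (a : ℝ≥0) :
    IsNowhereDense (coarseBall P a) := by
  set s := Real.exp a + 2 * a * Real.exp a with hs
  -- The bound for `P` is chosen for every `T` at once, since the radius `D + 1` used below depends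
  -- on the entourage.
  choose c hc using fun T => exists_not_crowded P.out one_pos
    (Real.exp a * T + 2 * a * Real.exp a)
  have hspos : 0 < s := by positivity
  set O : Set GromovSpace := ⋃ T, {Q | ∃ A, ⟦A⟧ = Q ∧ Crowded s T (c T) A} with hO
  have hopen : IsOpen O := isOpen_iUnion fun T => isOpen_crowded s T (c T)
  have hsub : closure (coarseBall P a) ⊆ Oᶜ := by
    refine closure_minimal (fun Q hQ hQO => ?_) hopen.isClosed_compl
    obtain ⟨T, A, rfl, hA⟩ := Set.mem_iUnion.1 hQO
    refine hc T (Crowded.of_coarseEmb ?_ hA)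
    simpa using CoarseEmb.trans hQ (.of_equiv (Quotient.mk_out A))
  refine Set.eq_empty_iff_forall_notMem.2 fun Q hQ => ?_
  obtain ⟨R, hR, r, hr, h⟩ :=
    (isOpen_interior : IsOpen (interior (closure (coarseBall P a)))) Q hQ
  -- `D ≥ R` hides the new points from the entourage; `D > s` separates them enough.
  set D := max R (s + 1)
  have hD : s < D := (lt_add_one s).trans_le (le_max_right _ _)
  refine hsub (interior_subset (h ⟦attachPoints Q.out (c (D + 1) + 1) D⟧ ?_))
    (Set.mem_iUnion.2 ⟨D + 1, _, rfl, crowded_attachPoints _ _ (hspos.trans hD) hD⟩)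
  conv_lhs => rw [← Q.out_eq]
  exact close_attachPoints _ _ hr (le_max_left _ _)

/-! ### Comparison with the quasi-isometric distance and relation -/

/-- The infimum of the `a` such that `Q` lies in `coarseBall P a`. -/
noncomputable def coarseDist (P Q : GromovSpace) : ℝ≥0∞ := ⨅ (a : ℝ≥0) (_ : Q ∈ coarseBall P a), (a : ℝ≥0∞)

theorem coarseDist_triangle (P Q S : GromovSpace) :
    coarseDist P S ≤ coarseDist P Q + coarseDist Q S := by
  refine ENNReal.le_iInf₂_add_iInf₂ fun a ha b hb => ?_
  exact (iInf₂_le (a + b) (mem_coarseBall_trans ha hb)).trans (by push_cast; exact le_rfl)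

theorem coarseDist_le_of_forall_lt {P Q : GromovSpace} {x : ℝ≥0∞}
    (h : ∀ a : ℝ≥0, x < a → Q ∈ coarseBall P a) : coarseDist P Q ≤ x := by
  by_contra! hlt
  obtain ⟨a, ha, ha'⟩ := ENNReal.lt_iff_exists_nnreal_btwn.1 hlt
  exact ha'.not_ge (iInf₂_le a (h a ha))

theorem coarseDist_le_dGH (P Q : GromovSpace) : coarseDist P Q ≤ dGH P Q := by
  rw [dGH_eq_ghDist_out]
  exact coarseDist_le_of_forall_lt fun _ => CoarseEmb.of_ghDist_lt

theorem coarseDist_le_dLip (P Q : GromovSpace) : coarseDist P Q ≤ dLip P Q := by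
  rw [dLip_eq_lipDist_out]
  exact coarseDist_le_of_forall_lt fun _ => CoarseEmb.of_lipDist_lt

theorem coarseDist_le_sum (c : ℕ → GromovSpace) (k : ℕ) :
    coarseDist (c 0) (c (2 * k)) ≤ ∑ i ∈ Finset.range k,
      (dGH (c (2 * i)) (c (2 * i + 1)) + dLip (c (2 * i + 1)) (c (2 * i + 2))) := by
  induction k with
  | zero => exact (iInf₂_le (0 : ℝ≥0) (mem_coarseBall_self _)).trans (by simp)
  | succ k ih =>
    rw [Finset.sum_range_succ]
    refine (coarseDist_triangle _ (c (2 * k)) _).trans (add_le_add ih ?_)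
    exact (coarseDist_triangle _ (c (2 * k + 1)) _).trans
      (add_le_add (coarseDist_le_dGH _ _) (coarseDist_le_dLip _ _))

/-- `coarseDist` satisfies the triangle inequality and is bounded by both `dGH` and `dLip`, hence by
the sum along every chain. -/
theorem coarseDist_le_dQI (P Q : GromovSpace) : coarseDist P Q ≤ dQI P Q := by
  refine le_iInf₂ fun k _ => le_iInf fun c => le_iInf₂ fun h₀ hk => ?_
  rw [← h₀, ← hk]
  exact coarseDist_le_sum c k

theorem ballQI_subset_coarseBall (P : GromovSpace) (r : ℝ) :
    ballQI P r ⊆ coarseBall P r.toNNReal := by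
  intro Q hQ
  have h := (coarseDist_le_dQI P Q).trans_lt hQ
  simp only [coarseDist, iInf_lt_iff] at h
  obtain ⟨a, ha, hlt⟩ := h
  exact CoarseEmb.mono (ENNReal.coe_le_coe.1 hlt.le) ha

/-- Coarse balls are not symmetric in centre and member, so both directions are carried to make the
induction pass through `symm`. -/
theorem EQI.exists_mem_coarseBall {P Q : GromovSpace} (h : EQI P Q) :
    ∃ a, Q ∈ coarseBall P a ∧ P ∈ coarseBall Q a := by
  induction h with
  | rel P Q h =>
    rcases h with h | h
    · obtain ⟨a, ha⟩ := ENNReal.lt_iff_exists_nnreal_btwn.1 h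
      have hlt := ha.1
      rw [dGH_eq_ghDist_out] at hlt
      exact ⟨a, CoarseEmb.of_ghDist_lt hlt,
        CoarseEmb.of_ghDist_lt ((ghDist_comm_le _ _).trans_lt hlt)⟩
    · exact h.lipEquivalent_out.exists_coarseEmb
  | refl P => exact ⟨0, mem_coarseBall_self P, mem_coarseBall_self P⟩
  | symm P Q _ ih =>
    obtain ⟨a, h₁, h₂⟩ := ih
    exact ⟨a, h₂, h₁⟩
  | trans P Q S _ _ ih ih' =>
    obtain ⟨a, h₁, h₂⟩ := ih
    obtain ⟨b, h₃, h₄⟩ := ih'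
    exact ⟨a + b, mem_coarseBall_trans h₁ h₃, add_comm a b ▸ mem_coarseBall_trans h₄ h₂⟩

end GromovSpace

theorem propositionp :
    (∀ P : GromovSpace, IsMeagre {Q : GromovSpace | GromovSpace.EQI P Q}) ∧
      (∀ (P : GromovSpace) (r : ℝ), 0 < r → IsNowhereDense (GromovSpace.ballQI P r)) := by
  refine ⟨fun P => ?_, fun P r _ =>
    (GromovSpace.isNowhereDense_coarseBall P r.toNNReal).mono
      (GromovSpace.ballQI_subset_coarseBall P r)⟩
  -- Radii in `ℕ` suffice by monotonicity, which makes the union countable.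
  refine IsMeagre.mono (s := ⋃ n : ℕ, GromovSpace.coarseBall P (n : ℝ≥0)) (fun Q hQ => ?_)
    (isMeagre_iUnion fun n : ℕ => (GromovSpace.isNowhereDense_coarseBall P n).isMeagre)
  obtain ⟨a, ha, -⟩ := GromovSpace.EQI.exists_mem_coarseBall hQ
  obtain ⟨n, hn⟩ := exists_nat_ge a
  exact Set.mem_iUnion.2 ⟨n, PointedProperSpace.CoarseEmb.mono hn ha⟩
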